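/- Let $U$ be the punctured unit disc $\{z\in\mathbb C: 0<|z|<1\}$ or the punctured plane $\mathbb C\setminus\{0\}$, and let $H(U)$ be the space of holomorphic functions $f:U\to\mathbb C$ with the compact-open topology. Let $\varphi:U\to U$ be a continuous map such that $f\circ\varphi\in H(U)$ for every $f\in H(U)$ (equivalently, a holomorphic self-map of $U$), and let $C_\varphi:H(U)\to H(U)$, $C_\varphi f=f\circ\varphi$, be the corresponding composition operator. Then $C_\varphi$ is not weakly supercyclic; that is, there is no $f\in H(U)$ for which $\{\lambda\, C_\varphi^{\,n} f:\ \lambda\in\mathbb C,\ n=0,1,2,\dots\}$ is dense in $H(U)$ with respect to the weak topology $\sigma(H(U),H(U)')$. -/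

import Mathlib

namespace WeakSupercyclic

/-- A continuous linear operator `T` on a complex topological vector space `E` is weakly
supercyclic if for some vector `f` the set of all `c • T ^ n f`, with `c : ℂ` and
`n = 0, 1, 2, …`, is dense in `E` for the weak topology `σ(E, E')`. -/
def IsWeaklySupercyclic {E : Type*} [AddCommMonoid E] [Module ℂ E] [TopologicalSpace E]
    (T : E →L[ℂ] E) : Prop :=
  ∃ f : E, Dense {y : WeakSpace ℂ E | ∃ (c : ℂ) (n : ℕ), y = toWeakSpace ℂ E (c • (T ^ n) f)}

/-- The space `H(U)` of holomorphic functions on an open set `U` of the complex plane, as a linear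
subspace of `C(U, ℂ)`. Its topology is the one induced by the compact-open topology. -/
def holFun (U : Set ℂ) : Submodule ℂ C(U, ℂ) where
  carrier := {f | ∃ g : ℂ → ℂ, DifferentiableOn ℂ g U ∧ ∀ z : U, f z = g z}
  zero_mem' := ⟨0, differentiableOn_const 0, fun _ => rfl⟩
  add_mem' := by
    rintro f₁ f₂ ⟨g₁, h₁, e₁⟩ ⟨g₂, h₂, e₂⟩
    exact ⟨g₁ + g₂, h₁.add h₂, fun z => by simp [e₁, e₂]⟩
  smul_mem' := by
    rintro c f ⟨g, h, e⟩
    exact ⟨c • g, h.const_smul c, fun z => by simp [e]⟩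

/-- A continuous map `φ : U → U` is the symbol of a composition operator on `H(U)` if `f ∘ φ` is
holomorphic for every `f` in `H(U)`. -/
def IsSymbol {U : Set ℂ} (φ : C(U, U)) : Prop :=
  ∀ f ∈ holFun U, f.comp φ ∈ holFun U

/-- The symbols of composition operators on `H(U)` are exactly the holomorphic self-maps of `U`. -/
theorem isSymbol_iff {U : Set ℂ} (φ : C(U, U)) :
    IsSymbol φ ↔ ∃ g : ℂ → ℂ, DifferentiableOn ℂ g U ∧ ∀ z : U, (φ z : ℂ) = g z := by
  constructor
  · intro h
    exact h ⟨Subtype.val, continuous_subtype_val⟩ ⟨id, differentiableOn_id, fun _ => rfl⟩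
  · rintro ⟨g, hg, e⟩ f ⟨k, hk, e'⟩
    refine ⟨k ∘ g, hk.comp hg fun z hz => ?_, fun z => ?_⟩
    · rw [← e ⟨z, hz⟩]
      exact (φ ⟨z, hz⟩).2
    · simp [e', e]

/-- The composition operator `C_φ : H(U) → H(U)`, `f ↦ f ∘ φ`, a continuous linear operator. -/
noncomputable def compOp (U : Set ℂ) (φ : C(U, U)) (hφ : IsSymbol φ) : holFun U →L[ℂ] holFun U where
  toFun f := ⟨(f : C(U, ℂ)).comp φ, hφ f f.2⟩
  map_add' _ _ := rfl
  map_smul' _ _ := rfl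
  cont := ((ContinuousMap.continuous_precomp φ).comp continuous_subtype_val).subtype_mk _

/-- The punctured unit disc. -/
def puncturedDisc : Set ℂ := Metric.ball 0 1 \ {0}

/-- The punctured plane. -/
def puncturedPlane : Set ℂ := {0}ᶜ

end WeakSupercyclic

/-! A surjection onto ℂ² given by two continuous functionals is weakly continuous, so it would send
a weakly dense projective orbit to a dense set. It is enough to find functionals on which the
operator acts too simply for that: the adjoint kills one
(`not_isWeaklySupercyclic_of_comp_eq_zero`), or has two independent eigenvectors
(`not_isWeaklySupercyclic_of_eigen`), or the operator is an involution
(`not_isWeaklySupercyclic_of_involutive`).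

If φ x = φ y with x ≠ y, the adjoint kills the difference of the evaluations at x and y. If φ
extends across 0 with value in U, it kills the residue at 0, by Cauchy's theorem. If φ is conjugate
near 0 to w ↦ c w with c ≠ 0, the Laurent coefficients in the coordinate w are eigenvectors
(`not_isWeaklySupercyclic_of_linearization`).

These cases are exhaustive, up to the involutions z ↦ 1 / (a z) of the plane. On the disc the
singularity is removable; an injective map fixing 0 is a rotation or has 0 < |φ'(0)| < 1, by
Schwarz's lemma, and then Koenigs' theorem linearizes it. On the plane an injective map has at most
a pole at 0 (`tendsto_or_tendsto_inv_of_injOn`), and an injective entire map fixing 0 is linear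
(`eq_mul_of_injective`). -/

namespace WeakSupercyclic

open Filter Topology Metric

/-! ### Obstructions to weak supercyclicity from pairs of functionals -/

section Criteria

variable {E : Type*} [AddCommMonoid E] [Module ℂ E] [TopologicalSpace E]

theorem prod_surjective_of_det_ne_zero {Λ M : E →L[ℂ] ℂ} {u v : E}
    (h : Λ u * M v - Λ v * M u ≠ 0) : Function.Surjective (Λ.prod M) := by
  rintro ⟨a, b⟩
  refine ⟨((a * M v - b * Λ v) / (Λ u * M v - Λ v * M u)) • u +
    ((b * Λ u - a * M u) / (Λ u * M v - Λ v * M u)) • v, ?_⟩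
  refine Prod.ext ?_ ?_
  · simp only [ContinuousLinearMap.prod_apply, map_add, map_smul, Prod.fst_add, Prod.smul_fst,
      smul_eq_mul]
    rw [div_mul_eq_mul_div, div_mul_eq_mul_div, ← add_div, div_eq_iff h]
    ring
  · simp only [ContinuousLinearMap.prod_apply, map_add, map_smul, Prod.snd_add, Prod.smul_snd,
      smul_eq_mul]
    rw [div_mul_eq_mul_div, div_mul_eq_mul_div, ← add_div, div_eq_iff h]
    ring

/-- A surjective continuous linear map onto a plane sends weakly dense projective orbits to dense
sets. -/
theorem IsWeaklySupercyclic.exists_dense_image {T : E →L[ℂ] E} (hT : IsWeaklySupercyclic T)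
    {Λ M : E →L[ℂ] ℂ} (hs : Function.Surjective (Λ.prod M)) :
    ∃ f : E, Dense {p : ℂ × ℂ | ∃ (c : ℂ) (n : ℕ),
      p = (c * Λ ((T ^ n) f), c * M ((T ^ n) f))} := by
  obtain ⟨f, hf⟩ := hT
  have hcont : ∀ Λ : E →L[ℂ] ℂ, Continuous fun x : WeakSpace ℂ E => Λ ((toWeakSpace ℂ E).symm x) :=
    fun Λ => WeakBilin.eval_continuous _ Λ
  have hd : DenseRange fun x : WeakSpace ℂ E =>
      (Λ ((toWeakSpace ℂ E).symm x), M ((toWeakSpace ℂ E).symm x)) := by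
    refine Function.Surjective.denseRange fun p => ?_
    obtain ⟨x, hx⟩ := hs p
    exact ⟨toWeakSpace ℂ E x, hx⟩
  refine ⟨f, (hd.dense_image ((hcont Λ).prodMk (hcont M)) hf).mono ?_⟩
  rintro _ ⟨_, ⟨c, n, rfl⟩, rfl⟩
  exact ⟨c, n, by simp⟩

/-- Subspaces of ℂ² are closed, and over an infinite field two proper subspaces cannot cover the
space. -/
theorem not_dense_of_subset_union_submodules {s : Set (ℂ × ℂ)} {p q : Submodule ℂ (ℂ × ℂ)}
    (hp : p ≠ ⊤) (hq : q ≠ ⊤) (hs : s ⊆ p ∪ q) : ¬ Dense s := by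
  intro hd
  have hc : IsClosed ((p : Set (ℂ × ℂ)) ∪ q) :=
    p.closed_of_finiteDimensional.union q.closed_of_finiteDimensional
  have huniv : ((p : Set (ℂ × ℂ)) ∪ q) = Set.univ :=
    Set.eq_univ_of_univ_subset (hd.closure_eq ▸ closure_minimal hs hc)
  have := Subspace.top_mem_of_biUnion_eq_univ (k := ℂ) (s := ({p, q} : Finset _))
    (by simpa using huniv)
  simp only [Finset.mem_insert, Finset.mem_singleton] at this
  exact this.elim (fun h => hp h.symm) fun h => hq h.symm

theorem span_singleton_ne_top (u : ℂ × ℂ) : Submodule.span ℂ {u} ≠ ⊤ := by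
  intro h
  have h1 := finrank_span_le_card (R := ℂ) ({u} : Set (ℂ × ℂ))
  rw [h, finrank_top] at h1
  simp at h1

theorem ker_fst_ne_top : LinearMap.ker (LinearMap.fst ℂ ℂ ℂ) ≠ ⊤ := by
  intro h
  have : ((1, 0) : ℂ × ℂ) ∈ LinearMap.ker (LinearMap.fst ℂ ℂ ℂ) := h ▸ Submodule.mem_top
  simp at this

/-- An operator whose adjoint kills a functional is not weakly supercyclic. -/
theorem not_isWeaklySupercyclic_of_comp_eq_zero {T : E →L[ℂ] E} {Λ M : E →L[ℂ] ℂ} {u v : E}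
    (hdet : Λ u * M v - Λ v * M u ≠ 0) (hΛ : ∀ f, Λ (T f) = 0) : ¬ IsWeaklySupercyclic T := by
  intro hT
  obtain ⟨f, hf⟩ := hT.exists_dense_image (prod_surjective_of_det_ne_zero hdet)
  refine not_dense_of_subset_union_submodules (span_singleton_ne_top (Λ f, M f)) ker_fst_ne_top
    ?_ hf
  -- The terms with n = 0 fill the line through (Λ f, M f); all later ones have first coordinate 0.
  rintro _ ⟨c, n, rfl⟩
  cases n with
  | zero => exact Or.inl (Submodule.mem_span_singleton.2 ⟨c, by simp⟩)
  | succ n =>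
    refine Or.inr ?_
    simp [pow_succ', hΛ]

/-- An involution is not weakly supercyclic on a space with two independent functionals. -/
theorem not_isWeaklySupercyclic_of_involutive {T : E →L[ℂ] E} {Λ M : E →L[ℂ] ℂ} {u v : E}
    (hdet : Λ u * M v - Λ v * M u ≠ 0) (hT2 : ∀ f, T (T f) = f) : ¬ IsWeaklySupercyclic T := by
  intro hT
  obtain ⟨f, hf⟩ := hT.exists_dense_image (prod_surjective_of_det_ne_zero hdet)
  refine not_dense_of_subset_union_submodules (span_singleton_ne_top (Λ f, M f))
    (span_singleton_ne_top (Λ (T f), M (T f))) ?_ hf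
  rintro _ ⟨c, n, rfl⟩
  have hn : (T ^ n) f = f ∨ (T ^ n) f = T f := by
    induction n with
    | zero => simp
    | succ n ih =>
      rw [pow_succ', mul_apply_eq_comp]
      rcases ih with h | h <;> simp [h, hT2]
  rcases hn with h | h <;> rw [h]
  · exact Or.inl (Submodule.mem_span_singleton.2 ⟨c, by simp⟩)
  · exact Or.inr (Submodule.mem_span_singleton.2 ⟨c, by simp⟩)

theorem apply_pow_of_eigen {T : E →L[ℂ] E} {Λ : E →L[ℂ] ℂ} {α : ℂ}
    (hΛ : ∀ f, Λ (T f) = α * Λ f) (n : ℕ) (f : E) : Λ ((T ^ n) f) = α ^ n * Λ f := by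
  induction n with
  | zero => simp
  | succ n ih => rw [pow_succ', mul_apply_eq_comp, hΛ, ih]; ring

/-- The n-th image is a multiple of (α ^ n Λ f, β ^ n M f), and |α| ≤ |β| keeps the ratio of its
coordinates on one side of the ratio for n = 0, which is a closed condition. -/
theorem not_isWeaklySupercyclic_of_eigen_of_norm_le {T : E →L[ℂ] E} {Λ M : E →L[ℂ] ℂ} {u v : E}
    {α β : ℂ} (hdet : Λ u * M v - Λ v * M u ≠ 0) (hΛ : ∀ f, Λ (T f) = α * Λ f)
    (hM : ∀ f, M (T f) = β * M f) (hαβ : ‖α‖ ≤ ‖β‖) : ¬ IsWeaklySupercyclic T := by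
  intro hT
  obtain ⟨f, hf⟩ := hT.exists_dense_image (prod_surjective_of_det_ne_zero hdet)
  set S : Set (ℂ × ℂ) := {p | ‖p.1‖ * ‖M f‖ ≤ ‖p.2‖ * ‖Λ f‖} with hS
  have hSc : IsClosed S := isClosed_le (by fun_prop) (by fun_prop)
  have hsub : {p : ℂ × ℂ | ∃ (c : ℂ) (n : ℕ), p = (c * Λ ((T ^ n) f), c * M ((T ^ n) f))} ⊆ S := by
    rintro _ ⟨c, n, rfl⟩
    simp only [hS, Set.mem_ofPred_eq, apply_pow_of_eigen hΛ, apply_pow_of_eigen hM, norm_mul,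
      norm_pow]
    have := pow_le_pow_left₀ (norm_nonneg α) hαβ n
    calc ‖c‖ * (‖α‖ ^ n * ‖Λ f‖) * ‖M f‖ = ‖α‖ ^ n * (‖c‖ * ‖Λ f‖ * ‖M f‖) := by ring
      _ ≤ ‖β‖ ^ n * (‖c‖ * ‖Λ f‖ * ‖M f‖) := by gcongr
      _ = _ := by ring
  have huniv : S = Set.univ :=
    Set.eq_univ_of_univ_subset (hf.closure_eq ▸ closure_minimal hsub hSc)
  -- Density makes the closed condition hold everywhere; at (1, 0) it forces M f = 0, so the image
  -- lies in a line after all.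
  have h1 : ((1, 0) : ℂ × ℂ) ∈ S := huniv ▸ Set.mem_univ _
  have hMf : M f = 0 := by simpa [hS] using h1
  have hker : LinearMap.ker (LinearMap.snd ℂ ℂ ℂ) ≠ ⊤ := by
    intro h
    have : ((0, 1) : ℂ × ℂ) ∈ LinearMap.ker (LinearMap.snd ℂ ℂ ℂ) := h ▸ Submodule.mem_top
    simp at this
  refine not_dense_of_subset_union_submodules hker hker ?_ hf
  rintro _ ⟨c, n, rfl⟩
  left
  change c * M ((T ^ n) f) = 0
  rw [apply_pow_of_eigen hM, hMf, mul_zero, mul_zero]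

/-- An operator whose adjoint has two linearly independent eigenvectors is not weakly
supercyclic. -/
theorem not_isWeaklySupercyclic_of_eigen {T : E →L[ℂ] E} {Λ M : E →L[ℂ] ℂ} {u v : E}
    {α β : ℂ} (hdet : Λ u * M v - Λ v * M u ≠ 0) (hΛ : ∀ f, Λ (T f) = α * Λ f)
    (hM : ∀ f, M (T f) = β * M f) : ¬ IsWeaklySupercyclic T := by
  rcases le_total ‖α‖ ‖β‖ with h | h
  · exact not_isWeaklySupercyclic_of_eigen_of_norm_le hdet hΛ hM h
  · refine not_isWeaklySupercyclic_of_eigen_of_norm_le (u := v) (v := u) ?_ hM hΛ h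
    convert hdet using 1
    ring

end Criteria

/-! ### Evaluations and contour integrals as functionals on H(U) -/

section Functionals

variable {U : Set ℂ}

/-- The extension by zero of a function in `H(U)` to the whole plane. -/
noncomputable def extendZero (f : holFun U) (z : ℂ) : ℂ :=
  open Classical in if h : z ∈ U then f.1 ⟨z, h⟩ else 0

theorem extendZero_of_mem (f : holFun U) {z : ℂ} (h : z ∈ U) : extendZero f z = f.1 ⟨z, h⟩ :=
  dif_pos h

theorem differentiableOn_extendZero (f : holFun U) : DifferentiableOn ℂ (extendZero f) U := by
  obtain ⟨g, hg, e⟩ := f.2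
  exact hg.congr fun z hz => (extendZero_of_mem f hz).trans (e ⟨z, hz⟩)

theorem extendZero_compOp {φ : C(U, U)} (hφ : IsSymbol φ) (f : holFun U) {z : ℂ} (h : z ∈ U) :
    extendZero (compOp U φ hφ f) z = extendZero f (φ ⟨z, h⟩) := by
  rw [extendZero_of_mem _ h, extendZero_of_mem _ (φ ⟨z, h⟩).2]
  rfl

/-- A holomorphic function on the plane, restricted to `U`. -/
def restrict (U : Set ℂ) (g : ℂ → ℂ) (hg : DifferentiableOn ℂ g U) : holFun U :=
  ⟨⟨fun z => g z, hg.continuousOn.domRestrict⟩, g, hg, fun _ => rfl⟩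

theorem extendZero_restrict {g : ℂ → ℂ} (hg : DifferentiableOn ℂ g U) {z : ℂ} (h : z ∈ U) :
    extendZero (restrict U g hg) z = g z :=
  extendZero_of_mem _ h

/-- Evaluation at a point of `U`. -/
noncomputable def evalAt (x : U) : holFun U →L[ℂ] ℂ where
  toFun f := f.1 x
  map_add' _ _ := rfl
  map_smul' _ _ := rfl
  cont := (continuous_eval_const x).comp continuous_subtype_val

/-- The difference of the values at two points of `U`. -/
noncomputable def evalSub (x y : U) : holFun U →L[ℂ] ℂ where
  toFun f := f.1 x - f.1 y
  map_add' f g := add_sub_add_comm (f.1 x) (g.1 x) (f.1 y) (g.1 y)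
  map_smul' c f := (mul_sub c (f.1 x) (f.1 y)).symm
  cont := (evalAt x).continuous.sub (evalAt y).continuous

/-- The integral of a function in `H(U)` along a parametrized curve, with a continuous weight. -/
noncomputable def pathFunctional (γ : C(ℝ, U)) (k : C(ℝ, ℂ)) : holFun U →L[ℂ] ℂ where
  toFun f := ∫ t in (0 : ℝ)..2 * Real.pi, k t * f.1 (γ t)
  map_add' f g := by
    rw [← intervalIntegral.integral_add]
    · simp [mul_add]
    · exact (k.continuous.mul (f.1.continuous.comp γ.continuous)).intervalIntegrable _ _
    · exact (k.continuous.mul (g.1.continuous.comp γ.continuous)).intervalIntegrable _ _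
  map_smul' c f := by
    rw [RingHom.id_apply, smul_eq_mul, ← intervalIntegral.integral_const_mul]
    simp [mul_left_comm]
  cont := by
    have h : Continuous fun f : C(ℝ, ℂ) => ∫ t in (0 : ℝ)..2 * Real.pi, k t * f t := by
      refine intervalIntegral.continuous_parametric_intervalIntegral_of_continuous' ?_ _ _
      exact (k.continuous.comp continuous_snd).mul continuous_eval
    exact h.comp ((ContinuousMap.continuous_precomp γ).comp continuous_subtype_val)

/-- Weighted integrals along the image of a circle are continuous functionals. -/
theorem exists_circle_functional {τ : ℂ → ℂ} {ρ : ℝ} (hρ : 0 < ρ)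
    (hτ : ContinuousOn τ (sphere 0 ρ)) (hτU : Set.MapsTo τ (sphere 0 ρ) U) (m : ℤ) :
    ∃ Λ : holFun U →L[ℂ] ℂ, ∀ f, Λ f = ∮ w in C(0, ρ), w ^ m * extendZero f (τ w) := by
  have hs : ∀ t, circleMap 0 ρ t ∈ sphere (0 : ℂ) ρ := circleMap_mem_sphere 0 hρ.le
  have hc : Continuous fun t => τ (circleMap 0 ρ t) :=
    hτ.comp_continuous (continuous_circleMap 0 ρ) hs
  have h0 : ∀ t, circleMap 0 ρ t ≠ 0 := fun t => circleMap_ne_center hρ.ne'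
  refine ⟨pathFunctional ⟨fun t => ⟨τ (circleMap 0 ρ t), hτU (hs t)⟩, hc.subtype_mk _⟩
    ⟨fun t => circleMap 0 ρ t * Complex.I * circleMap 0 ρ t ^ m, ?_⟩, fun f => ?_⟩
  · exact ((continuous_circleMap 0 ρ).mul continuous_const).mul
      ((continuous_circleMap 0 ρ).zpow₀ m fun t => Or.inl (h0 t))
  · refine intervalIntegral.integral_congr fun t _ => ?_
    simp only [ContinuousMap.coe_mk, deriv_circleMap, smul_eq_mul]
    rw [extendZero_of_mem f (hτU (hs t)), mul_assoc]

/-- Multiplication by c scales the circle by |c| and shifts its parameter by arg c; the shift is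
harmless by periodicity. -/
theorem circleIntegral_comp_mul_left (F : ℂ → ℂ) (c : ℂ) (ρ : ℝ) :
    c * ∮ w in C(0, ρ), F (c * w) = ∮ w in C(0, ‖c‖ * ρ), F w := by
  have hc : ∀ t, c * circleMap 0 ρ t = circleMap 0 (‖c‖ * ρ) (t + c.arg) := by
    intro t
    conv_lhs => rw [← Complex.norm_mul_exp_arg_mul_I c]
    simp only [circleMap_zero, Complex.ofReal_mul, Complex.ofReal_add, add_mul, Complex.exp_add]
    ring
  set g : ℝ → ℂ := fun t => deriv (circleMap 0 (‖c‖ * ρ)) t • F (circleMap 0 (‖c‖ * ρ) t) with hg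
  have hper : Function.Periodic g (2 * Real.pi) := by
    intro t
    simp only [hg, deriv_circleMap, periodic_circleMap 0 (‖c‖ * ρ) t]
  have h1 : c * ∮ w in C(0, ρ), F (c * w) = ∫ t in (0 : ℝ)..2 * Real.pi, g (t + c.arg) := by
    rw [circleIntegral, ← intervalIntegral.integral_const_mul]
    refine intervalIntegral.integral_congr fun t _ => ?_
    simp only [hg, deriv_circleMap, smul_eq_mul, ← hc]
    ring
  rw [h1, intervalIntegral.integral_comp_add_right, circleIntegral]
  have := hper.intervalIntegral_add_eq (0 + c.arg) 0
  rw [zero_add] at this ⊢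
  rw [add_comm (2 * Real.pi), this, zero_add]

theorem circleIntegral_eq_of_differentiableOn_punctured {F : ℂ → ℂ} {R r₁ r₂ : ℝ}
    (hF : DifferentiableOn ℂ F (ball 0 R \ {0})) (h₁ : 0 < r₁) (h₁R : r₁ < R) (h₂ : 0 < r₂)
    (h₂R : r₂ < R) : ∮ w in C(0, r₁), F w = ∮ w in C(0, r₂), F w := by
  wlog h : r₂ ≤ r₁ generalizing r₁ r₂
  · exact (this h₂ h₂R h₁ h₁R (le_of_not_ge h)).symm
  have hsub : closedBall (0 : ℂ) r₁ \ ball 0 r₂ ⊆ ball 0 R \ {0} := fun w hw =>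
    ⟨closedBall_subset_ball h₁R hw.1, by rintro rfl; exact hw.2 (mem_ball_self h₂)⟩
  refine Complex.circleIntegral_eq_of_differentiable_on_annulus_off_countable h₂ h
    Set.countable_empty (hF.continuousOn.mono hsub) fun z hz => ?_
  refine hF.differentiableAt ((isOpen_ball.sdiff isClosed_singleton).mem_nhds (hsub ?_))
  exact ⟨ball_subset_closedBall hz.1.1, fun h => hz.1.2 (ball_subset_closedBall h)⟩

/-- If `φ` is conjugate near a puncture to the multiplication by a nonzero constant, then the
composition operator is not weakly supercyclic. -/
theorem not_isWeaklySupercyclic_of_linearization {φ : C(U, U)} (hφ : IsSymbol φ)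
    {τ : ℂ → ℂ} {R ρ : ℝ} {c : ℂ} (hc : c ≠ 0) (hρ : 0 < ρ) (hρR : ρ < R) (hcρ : ‖c‖ * ρ < R)
    (hτ : DifferentiableOn ℂ τ (ball 0 R)) (hτU : Set.MapsTo τ (ball 0 R \ {0}) U)
    (hτ' : deriv τ 0 ≠ 0)
    (hconj : ∀ w (hw : w ∈ ball (0 : ℂ) R \ {0}), ‖c * w‖ < R → (φ ⟨τ w, hτU hw⟩ : ℂ) = τ (c * w)) :
    ¬ IsWeaklySupercyclic (compOp U φ hφ) := by
  have hsph : sphere (0 : ℂ) ρ ⊆ ball 0 R \ {0} := by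
    intro w hw
    rw [mem_sphere_zero_iff_norm] at hw
    refine ⟨by simpa [hw] using hρR, ?_⟩
    rintro rfl
    exact hρ.ne (by simpa using hw)
  have hτs : ContinuousOn τ (sphere 0 ρ) := hτ.continuousOn.mono (hsph.trans Set.sdiff_subset)
  have hτsU : Set.MapsTo τ (sphere 0 ρ) U := hτU.mono_left hsph
  -- Substituting c w for w yields the factor c ^ (-(m + 1)) and moves the contour to radius |c| ρ;
  -- the integrand is holomorphic off 0, so the contour can be moved back.
  have eigen : ∀ (m : ℤ) (f : holFun U),
      ∮ w in C(0, ρ), w ^ m * extendZero (compOp U φ hφ f) (τ w) =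
        (c ^ (m + 1))⁻¹ * ∮ w in C(0, ρ), w ^ m * extendZero f (τ w) := by
    intro m f
    set F : ℂ → ℂ := fun w => w ^ m * extendZero f (τ w) with hF
    have hFd : DifferentiableOn ℂ F (ball 0 R \ {0}) := by
      refine DifferentiableOn.mul (fun w hw => ?_) ?_
      · exact (differentiableAt_zpow.2 (Or.inl hw.2)).differentiableWithinAt
      · exact (differentiableOn_extendZero f).comp (hτ.mono Set.sdiff_subset) hτU
    have h1 : ∮ w in C(0, ρ), w ^ m * extendZero (compOp U φ hφ f) (τ w) =
        ∮ w in C(0, ρ), (c ^ m)⁻¹ * F (c * w) := by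
      refine circleIntegral.integral_congr hρ.le fun w hw => ?_
      have hn : ‖c * w‖ < R := by
        rw [norm_mul, mem_sphere_zero_iff_norm.1 hw]
        exact hcρ
      simp only [hF]
      rw [extendZero_compOp hφ f (hτU (hsph hw)), hconj w (hsph hw) hn, mul_zpow, ← mul_assoc,
        inv_mul_cancel_left₀ (zpow_ne_zero m hc)]
    rw [h1, circleIntegral.integral_const_mul,
      circleIntegral_eq_of_differentiableOn_punctured hFd hρ hρR
        (mul_pos (norm_pos_iff.2 hc) hρ) hcρ, ← circleIntegral_comp_mul_left, zpow_add_one₀ hc]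
    field_simp
  -- Up to 2πi, these are the Laurent coefficients of f ∘ τ of degrees 0 and 1. On the functions 1
  -- and z their matrix is triangular, with diagonal 2πi, 2πi τ'(0).
  obtain ⟨Λ, hΛ⟩ := exists_circle_functional hρ hτs hτsU (-1)
  obtain ⟨M, hM⟩ := exists_circle_functional hρ hτs hτsU (-2)
  have hext : ∀ (m : ℤ) {g : ℂ → ℂ} (hg : DifferentiableOn ℂ g U),
      ∮ w in C(0, ρ), w ^ m * extendZero (restrict U g hg) (τ w) =
        ∮ w in C(0, ρ), w ^ m * g (τ w) := fun m g hg =>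
    circleIntegral.integral_congr hρ.le fun w hw => by
      simp only [extendZero_restrict hg (hτsU hw)]
  have hd1 : DifferentiableOn ℂ (fun _ : ℂ => (1 : ℂ)) U := differentiableOn_const 1
  have hd2 : DifferentiableOn ℂ (fun z : ℂ => z) U := differentiableOn_id
  have hΛ1 : Λ (restrict U _ hd1) ≠ 0 := by
    have := circleIntegral.integral_sub_center_inv 0 hρ.ne'
    simp only [sub_zero] at this
    rw [hΛ, hext]
    simp only [zpow_neg_one, mul_one, this]
    exact Complex.two_pi_I_ne_zero
  have hM1 : M (restrict U _ hd1) = 0 := by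
    have := circleIntegral.integral_sub_zpow_of_ne (n := -2) (by decide) 0 0 ρ
    simp only [sub_zero] at this
    rw [hM, hext]
    simpa only [mul_one] using this
  have hM2 : M (restrict U _ hd2) ≠ 0 := by
    have := Complex.two_pi_I_inv_smul_circleIntegral_sub_sq_inv_smul_of_differentiable
      isOpen_ball (closedBall_subset_ball hρR) hτ (mem_ball_self hρ)
    simp only [sub_zero, smul_eq_mul] at this
    rw [hM, hext]
    intro h0
    refine hτ' ?_
    rw [← this, mul_eq_zero]
    exact Or.inr h0
  refine not_isWeaklySupercyclic_of_eigen (Λ := Λ) (M := M) (u := restrict U _ hd1)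
    (v := restrict U _ hd2) (α := (c ^ ((-1 : ℤ) + 1))⁻¹) (β := (c ^ ((-2 : ℤ) + 1))⁻¹) ?_
    (fun f => ?_) fun f => ?_
  · rw [hM1, mul_zero, sub_zero]
    exact mul_ne_zero hΛ1 hM2
  · rw [hΛ, hΛ, eigen]
  · rw [hM, hM, eigen]

/-- If `φ` is not injective, then the composition operator is not weakly supercyclic. -/
theorem not_isWeaklySupercyclic_of_not_injective {φ : C(U, U)} (hφ : IsSymbol φ)
    (h : ¬ Function.Injective φ) : ¬ IsWeaklySupercyclic (compOp U φ hφ) := by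
  simp only [Function.Injective, not_forall] at h
  obtain ⟨x, y, hxy, hne⟩ := h
  refine not_isWeaklySupercyclic_of_comp_eq_zero (Λ := evalSub x y) (M := evalAt x)
    (u := restrict U (fun z => z) differentiableOn_id)
    (v := restrict U (fun _ => 1) (differentiableOn_const 1)) ?_ fun f => ?_
  · change ((x : ℂ) - y) * 1 - (1 - 1) * x ≠ 0
    simpa [sub_eq_zero, Subtype.ext_iff] using hne
  · change f.1 (φ x) - f.1 (φ y) = 0
    rw [hxy, sub_self]

/-- If `φ` extends holomorphically across the puncture with values in `U`, then the composition
operator is not weakly supercyclic. -/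
theorem not_isWeaklySupercyclic_of_extends {φ : C(U, U)} (hφ : IsSymbol φ)
    (h0 : (0 : ℂ) ∉ U) {G : ℂ → ℂ} {R : ℝ} (hR : 0 < R) (hRU : ball 0 R \ {0} ⊆ U)
    (hG : DifferentiableOn ℂ G (ball 0 R)) (hG0 : G 0 ∈ U)
    (hφG : ∀ z : U, (φ z : ℂ) = G z) : ¬ IsWeaklySupercyclic (compOp U φ hφ) := by
  have hGU : Set.MapsTo G (ball 0 R) U := by
    intro z hz
    rcases eq_or_ne z 0 with rfl | hz0
    · exact hG0
    · exact hφG ⟨z, hRU ⟨hz, hz0⟩⟩ ▸ (φ _).2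
  have hρ : 0 < R / 2 := half_pos hR
  have hsph : sphere (0 : ℂ) (R / 2) ⊆ U := by
    intro w hw
    rw [mem_sphere_zero_iff_norm] at hw
    refine hRU ⟨by simpa [hw] using hR, ?_⟩
    rintro rfl
    exact hρ.ne (by simpa using hw)
  -- This is 2πi times the residue at 0, nonzero on 1 / z but zero on f ∘ φ, which extends
  -- holomorphically to the whole ball.
  obtain ⟨Λ, hΛ⟩ := exists_circle_functional (τ := fun z => z) hρ continuousOn_id hsph 0
  have hinv : DifferentiableOn ℂ (fun z : ℂ => z⁻¹) U :=
    differentiableOn_inv.mono fun z hz => by rintro rfl; exact h0 hz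
  have hd1 : DifferentiableOn ℂ (fun _ : ℂ => (1 : ℂ)) U := differentiableOn_const 1
  have hu : Λ (restrict U _ hinv) ≠ 0 := by
    have := circleIntegral.integral_sub_center_inv 0 hρ.ne'
    simp only [sub_zero] at this
    have h2 : Λ (restrict U _ hinv) = ∮ w in C(0, R / 2), w⁻¹ := by
      rw [hΛ]
      refine circleIntegral.integral_congr hρ.le fun w hw => ?_
      simp only [zpow_zero, one_mul, extendZero_restrict hinv (hsph hw)]
    rw [h2, this]
    exact Complex.two_pi_I_ne_zero
  have cauchy : ∀ g : ℂ → ℂ, DifferentiableOn ℂ g (ball 0 R) →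
      ∮ w in C(0, R / 2), g w = 0 := fun g hg =>
    (hg.diffContOnCl_ball (closedBall_subset_ball (half_lt_self hR))).circleIntegral_eq_zero hρ.le
  have hv : Λ (restrict U _ hd1) = 0 := by
    rw [hΛ]
    refine (circleIntegral.integral_congr hρ.le fun w hw => ?_).trans
      (cauchy (fun _ => 1) (differentiableOn_const 1))
    simp only [zpow_zero, one_mul, extendZero_restrict hd1 (hsph hw)]
  refine not_isWeaklySupercyclic_of_comp_eq_zero (Λ := Λ) (M := evalAt ⟨G 0, hG0⟩)
    (u := restrict U _ hinv) (v := restrict U _ hd1) ?_ fun f => ?_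
  · rw [hv, zero_mul, sub_zero]
    refine mul_ne_zero hu ?_
    change (1 : ℂ) ≠ 0
    exact one_ne_zero
  · rw [hΛ]
    refine (circleIntegral.integral_congr hρ.le fun w hw => ?_).trans
      (cauchy (fun z => extendZero f (G z)) ((differentiableOn_extendZero f).comp hG hGU))
    simp only [zpow_zero, one_mul]
    rw [extendZero_compOp hφ f (hsph hw), hφG]

end Functionals

/-! ### Injective holomorphic maps, Koenigs linearization and isolated singularities -/

section ComplexAnalysis

/-- The open mapping theorem; injectivity excludes a locally constant G. -/
theorem nhds_le_map_of_injOn {G : ℂ → ℂ} {s : Set ℂ} (hs : IsOpen s)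
    (hG : DifferentiableOn ℂ G s) (hinj : Set.InjOn G s) {x : ℂ} (hx : x ∈ s) :
    𝓝 (G x) ≤ map G (𝓝 x) := by
  refine (hG.analyticAt (hs.mem_nhds hx)).eventually_constant_or_nhds_le_map_nhds.resolve_left ?_
  intro h
  have h1 : ∀ᶠ z in 𝓝[≠] x, z = x := by
    filter_upwards [(h.and (hs.mem_nhds hx)).filter_mono nhdsWithin_le_nhds] with z hz
    exact hinj hz.2 hx hz.1
  obtain ⟨z, hz, hne⟩ := (h1.and self_mem_nhdsWithin).exists
  exact hne hz

/-- An injective holomorphic function has nonvanishing derivative. -/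
theorem deriv_ne_zero_of_injOn {G : ℂ → ℂ} {s : Set ℂ} (hs : IsOpen s)
    (hG : DifferentiableOn ℂ G s) (hinj : Set.InjOn G s) {x : ℂ} (hx : x ∈ s) :
    deriv G x ≠ 0 := by
  -- The inverse ψ is continuous at G x, and holomorphic near it except perhaps at G x itself,
  -- because zeros of G' are isolated. The singularity is removable, and the chain rule for ψ ∘ G =
  -- id gives G'(x) ≠ 0.
  set ψ := Function.invFunOn G s with hψ
  have hleft : ∀ z ∈ s, ψ (G z) = z := fun z hz => hinj.leftInvOn_invFunOn hz
  have hcont : ContinuousAt ψ (G x) := by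
    intro N hN
    rw [hleft x hx] at hN
    have himg := nhds_le_map_of_injOn hs hG hinj hx
      (image_mem_map (inter_mem hN (hs.mem_nhds hx)))
    refine mem_map.2 (mem_of_superset himg ?_)
    rintro _ ⟨w, hw, rfl⟩
    change ψ (G w) ∈ N
    rw [hleft w hw.2]
    exact hw.1
  have hGx := hG.analyticAt (hs.mem_nhds hx)
  have hne : ∀ᶠ z in 𝓝[≠] x, deriv G z ≠ 0 := by
    refine hGx.deriv.eventually_eq_zero_or_eventually_ne_zero.resolve_left fun h => ?_
    obtain ⟨ε, hε, hb⟩ := Metric.eventually_nhds_iff_ball.1 (h.and (hs.mem_nhds hx))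
    have h1 : ∀ᶠ z in 𝓝[≠] x, z = x := by
      filter_upwards [nhdsWithin_le_nhds (ball_mem_nhds x hε)] with z hz
      refine hinj (hb z hz).2 hx ?_
      exact isOpen_ball.is_const_of_deriv_eq_zero (convex_ball x ε).isPreconnected
        (hG.mono fun y hy => (hb y hy).2) (fun y hy => (hb y hy).1) hz (mem_ball_self hε)
    obtain ⟨z, hz, hzx⟩ := (h1.and self_mem_nhdsWithin).exists
    exact hzx hz
  have himg : ∀ᶠ y in 𝓝 (G x), ∃ z ∈ s, G z = y :=
    nhds_le_map_of_injOn hs hG hinj hx (image_mem_map (hs.mem_nhds hx))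
  have hdiff : ∀ᶠ y in 𝓝[≠] G x, DifferentiableAt ℂ ψ y := by
    have h1 : ∀ᶠ y in 𝓝 (G x), ψ y ≠ x → deriv G (ψ y) ≠ 0 := by
      have := eventually_nhdsWithin_iff.1 hne
      rw [← hleft x hx] at this
      filter_upwards [hcont.eventually this] with y hy hyx
      exact hy (by simpa [hleft x hx] using hyx)
    filter_upwards [nhdsWithin_le_nhds h1, nhdsWithin_le_nhds himg, self_mem_nhdsWithin]
      with y hy hyi hyx
    obtain ⟨z, hz, rfl⟩ := hyi
    rw [hleft z hz] at hy
    have hzx : z ≠ x := by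
      rintro rfl
      exact hyx rfl
    have h2 := (hG.analyticAt (hs.mem_nhds hz)).hasStrictDerivAt
    refine (h2.to_local_left_inverse (hy hzx) ?_).hasDerivAt.differentiableAt
    filter_upwards [hs.mem_nhds hz] with w hw using hleft w hw
  have hψx := (Complex.analyticAt_of_differentiable_on_punctured_nhds_of_continuousAt
    hdiff hcont).differentiableAt.hasDerivAt
  have hcomp := hψx.comp x hGx.differentiableAt.hasDerivAt
  have hid : HasDerivAt (ψ ∘ G) 1 x :=
    (hasDerivAt_id x).congr_of_eventuallyEq
      (by filter_upwards [hs.mem_nhds hx] with w hw using hleft w hw)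
  intro h0
  have := hcomp.unique hid
  simp [h0] at this

theorem exists_contraction_bounds {G : ℂ → ℂ} {c : ℂ} {r : ℝ} (hG : AnalyticAt ℂ G 0)
    (hG0 : G 0 = 0) (hd : deriv G 0 = c) (hr : ‖c‖ < r) :
    ∃ δ > 0, ∃ C, 0 ≤ C ∧ DifferentiableOn ℂ G (ball 0 δ) ∧
      (∀ z ∈ ball (0 : ℂ) δ, ‖G z‖ ≤ r * ‖z‖) ∧
      ∀ z ∈ ball (0 : ℂ) δ, ‖G z - c * z‖ ≤ C * ‖z‖ ^ 2 := by
  obtain ⟨s, hs, hGs⟩ := hG.exists_mem_nhds_analyticOnNhd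
  have hdG : DifferentiableOn ℂ G s := hGs.differentiableOn
  set h := dslope G 0 with hh
  have hhd : DifferentiableOn ℂ h s := (Complex.differentiableOn_dslope hs).2 hdG
  have hkd : DifferentiableOn ℂ (dslope h 0) s := (Complex.differentiableOn_dslope hs).2 hhd
  have hh0 : h 0 = c := by rw [hh, dslope_same, hd]
  have hGh : ∀ z, G z = z * h z := fun z => by
    have := sub_smul_dslope G 0 z
    simpa [hG0] using this.symm
  have hhk : ∀ z, h z - c = z * dslope h 0 z := fun z => by
    have := sub_smul_dslope h 0 z
    rw [hh0] at this
    simpa using this.symm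
  have hhc : ContinuousAt h 0 := (hhd.differentiableAt hs).continuousAt
  have hkc : ContinuousAt (dslope h 0) 0 := (hkd.differentiableAt hs).continuousAt
  have e1 : ∀ᶠ z in 𝓝 (0 : ℂ), ‖h z‖ < r :=
    hhc.norm.eventually_lt continuousAt_const (by rwa [hh0])
  have e2 : ∀ᶠ z in 𝓝 (0 : ℂ), ‖dslope h 0 z‖ < ‖dslope h 0 0‖ + 1 :=
    hkc.norm.eventually_lt continuousAt_const (lt_add_one _)
  obtain ⟨δ, hδ, hb⟩ := Metric.eventually_nhds_iff_ball.1 ((e1.and e2).and hs)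
  refine ⟨δ, hδ, ‖dslope h 0 0‖ + 1, by positivity, hdG.mono fun z hz => (hb z hz).2,
    fun z hz => ?_, fun z hz => ?_⟩
  · rw [hGh, norm_mul, mul_comm]
    exact mul_le_mul_of_nonneg_right (hb z hz).1.1.le (norm_nonneg z)
  · have : G z - c * z = z * (z * dslope h 0 z) := by rw [← hhk, hGh]; ring
    rw [this, norm_mul, norm_mul, ← mul_assoc, ← sq, mul_comm]
    exact mul_le_mul_of_nonneg_right (hb z hz).1.2.le (by positivity)

/-- **Koenigs' theorem**: a holomorphic germ with an attracting, not superattracting, fixed point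
is linearizable. -/
theorem exists_koenigs {G : ℂ → ℂ} {c : ℂ} (hG : AnalyticAt ℂ G 0) (hG0 : G 0 = 0)
    (hd : deriv G 0 = c) (hc : c ≠ 0) (hc1 : ‖c‖ < 1) :
    ∃ σ : ℂ → ℂ, AnalyticAt ℂ σ 0 ∧ σ 0 = 0 ∧ deriv σ 0 = 1 ∧
      ∀ᶠ z in 𝓝 0, σ (G z) = c * σ z := by
  have hcpos : 0 < ‖c‖ := norm_pos_iff.2 hc
  -- With r ^ 2 < |c|, the quadratic error of size r ^ (2 n) in G^[n] survives division by c ^ n.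
  obtain ⟨r, hr1, hr2⟩ : ∃ r, ‖c‖ < r ∧ r < √‖c‖ :=
    exists_between ((Real.lt_sqrt hcpos.le).2 (by nlinarith))
  have hr0 : 0 < r := hcpos.trans hr1
  have hrc : r ^ 2 < ‖c‖ := (Real.lt_sqrt hr0.le).1 hr2
  have hrlt : r ≤ 1 := by nlinarith
  obtain ⟨δ, hδ, C, hC, hGd, hGr, hGC⟩ := exists_contraction_bounds hG hG0 hd hr1
  have hmaps : Set.MapsTo G (ball 0 δ) (ball 0 δ) := fun z hz => by
    rw [mem_ball_zero_iff] at hz ⊢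
    exact (hGr z (mem_ball_zero_iff.2 hz)).trans_lt
      ((mul_le_of_le_one_left (norm_nonneg z) hrlt).trans_lt hz)
  have hit : ∀ n, ∀ z ∈ ball (0 : ℂ) δ, ‖G^[n] z‖ ≤ r ^ n * ‖z‖ := by
    intro n z hz
    induction n with
    | zero => simp
    | succ n ih =>
      rw [Function.iterate_succ_apply', pow_succ', mul_assoc]
      exact (hGr _ (hmaps.iterate n hz)).trans (mul_le_mul_of_nonneg_left ih hr0.le)
  -- These are the increments of G^[n] z / c ^ n, whose limit is Koenigs' coordinate.
  set u : ℕ → ℂ → ℂ := fun n z => (G^[n + 1] z - c * G^[n] z) / c ^ (n + 1) with hu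
  set q : ℝ := r ^ 2 / ‖c‖ with hq
  have hq0 : 0 ≤ q := by positivity
  have hq1 : q < 1 := (div_lt_one hcpos).2 hrc
  have hub : ∀ n, ∀ z ∈ ball (0 : ℂ) δ, ‖u n z‖ ≤ C / ‖c‖ * ‖z‖ ^ 2 * q ^ n := by
    intro n z hz
    have h1 := hGC _ (hmaps.iterate n hz)
    have h2 : ‖G^[n] z‖ ^ 2 ≤ (r ^ n * ‖z‖) ^ 2 :=
      pow_le_pow_left₀ (norm_nonneg _) (hit n z hz) 2
    simp only [hu, norm_div, norm_pow]
    rw [div_le_iff₀ (by positivity), Function.iterate_succ_apply']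
    calc ‖G (G^[n] z) - c * G^[n] z‖ ≤ C * (r ^ n * ‖z‖) ^ 2 :=
          h1.trans (mul_le_mul_of_nonneg_left h2 hC)
      _ = _ := by
        rw [hq, div_pow, pow_succ ‖c‖]
        field_simp
        ring
  set K : ℝ := C / ‖c‖ * (1 - q)⁻¹ with hK
  have hgeo : ∀ a : ℝ, HasSum (fun n : ℕ => a * q ^ n) (a * (1 - q)⁻¹) := fun a =>
    (hasSum_geometric_of_lt_one hq0 hq1).mul_left a
  have hsum : ∀ z ∈ ball (0 : ℂ) δ, Summable fun n => u n z := fun z hz =>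
    Summable.of_norm_bounded (hgeo _).summable fun n => hub n z hz
  set σ : ℂ → ℂ := fun z => z + ∑' n, u n z with hσ
  have hσd : DifferentiableOn ℂ σ (ball 0 δ) := by
    refine differentiableOn_id.add (Complex.differentiableOn_tsum_of_summable_norm
      (hgeo (C / ‖c‖ * δ ^ 2)).summable (fun n => ?_) isOpen_ball fun n z hz => ?_)
    · exact ((hGd.iterate hmaps (n + 1)).sub ((hGd.iterate hmaps n).const_mul c)).div_const _
    · refine (hub n z hz).trans ?_
      have : ‖z‖ ≤ δ := (mem_ball_zero_iff.1 hz).le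
      gcongr
  have hσb : ∀ z ∈ ball (0 : ℂ) δ, ‖σ z - z‖ ≤ K * ‖z‖ ^ 2 := by
    intro z hz
    have := tsum_of_norm_bounded (hgeo _) fun n => hub n z hz
    simp only [hσ, add_sub_cancel_left]
    refine this.trans_eq ?_
    rw [hK]
    ring
  have hσ0 : σ 0 = 0 := by
    simpa using hσb 0 (mem_ball_self hδ)
  have hderiv : HasDerivAt σ 1 0 := by
    rw [hasDerivAt_iff_isLittleO]
    have hO : (fun z => σ z - σ 0 - (z - 0) • (1 : ℂ)) =O[𝓝 0] fun z : ℂ => z ^ 2 := by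
      refine Asymptotics.IsBigO.of_bound K ?_
      filter_upwards [ball_mem_nhds (0 : ℂ) hδ] with z hz
      simpa [hσ0] using hσb z hz
    refine hO.trans_isLittleO ?_
    simpa using Asymptotics.isLittleO_pow_id (𝕜 := ℂ) one_lt_two
  have hpart : ∀ N z, z + ∑ n ∈ Finset.range N, u n z = G^[N] z / c ^ N := by
    intro N z
    induction N with
    | zero => simp
    | succ N ih =>
      rw [Finset.sum_range_succ, ← add_assoc, ih]
      simp only [hu]
      field_simp
      ring
  have hlim : ∀ z ∈ ball (0 : ℂ) δ, Tendsto (fun N => G^[N] z / c ^ N) atTop (𝓝 (σ z)) := by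
    intro z hz
    refine ((hsum z hz).hasSum.tendsto_sum_nat.const_add z).congr fun N => hpart N z
  refine ⟨σ, hσd.analyticAt (ball_mem_nhds 0 hδ), hσ0, hderiv.deriv, ?_⟩
  filter_upwards [ball_mem_nhds (0 : ℂ) hδ] with z hz
  refine tendsto_nhds_unique (hlim (G z) (hmaps hz)) ?_
  refine (((tendsto_add_atTop_iff_nat 1).2 (hlim z hz)).const_mul c).congr fun N => ?_
  rw [Function.iterate_succ_apply, pow_succ]
  field_simp

/-- The inverse of Koenigs' coordinate: near an attracting fixed point a germ is conjugate to its
linear part. -/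
theorem exists_linearization {G : ℂ → ℂ} {c : ℂ} (hG : AnalyticAt ℂ G 0) (hG0 : G 0 = 0)
    (hd : deriv G 0 = c) (hc : c ≠ 0) (hc1 : ‖c‖ < 1) {V : Set ℂ} (hV : V ∈ 𝓝 0) :
    ∃ τ : ℂ → ℂ, ∃ R > 0, DifferentiableOn ℂ τ (ball 0 R) ∧
      Set.MapsTo τ (ball 0 R \ {0}) (V \ {0}) ∧ deriv τ 0 ≠ 0 ∧
      ∀ w ∈ ball (0 : ℂ) R, G (τ w) = τ (c * w) := by
  obtain ⟨σ, hσ, hσ0, hσ1, heq⟩ := exists_koenigs hG hG0 hd hc hc1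
  have hσ' : deriv σ 0 ≠ 0 := by rw [hσ1]; exact one_ne_zero
  have hst := hσ.hasStrictDerivAt
  set τ := hst.localInverse σ (deriv σ 0) 0 hσ' with hτ
  have hτa : AnalyticAt ℂ τ 0 := by
    have := hσ.analyticAt_localInverse hσ'
    rwa [hσ0] at this
  have hleft : ∀ᶠ z in 𝓝 0, τ (σ z) = z := hst.eventually_left_inverse hσ'
  have hright : ∀ᶠ w in 𝓝 0, σ (τ w) = w := by
    have := hst.eventually_right_inverse hσ'
    rwa [hσ0] at this
  have hτ0 : τ 0 = 0 := by
    have := hleft.self_of_nhds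
    rwa [hσ0] at this
  have hτ' : deriv τ 0 ≠ 0 := by
    have := (hst.to_localInverse hσ').hasDerivAt.deriv
    rw [hσ0] at this
    rw [hτ, this]
    exact inv_ne_zero hσ'
  have hτt : Tendsto τ (𝓝 0) (𝓝 0) := by
    have := hτa.continuousAt.tendsto
    rwa [hτ0] at this
  have hGt : Tendsto G (𝓝 0) (𝓝 0) := by
    have := hG.continuousAt.tendsto
    rwa [hG0] at this
  obtain ⟨s, hs, hτs⟩ := hτa.exists_mem_nhds_analyticOnNhd
  have hall := (((hτt.eventually hV).and hright).and (hτt.eventually heq)).and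
    (((hGt.comp hτt).eventually hleft).and hs)
  obtain ⟨R, hR, hb⟩ := Metric.eventually_nhds_iff_ball.1 hall
  refine ⟨τ, R, hR, fun w hw => (hτs w (hb w hw).2.2).differentiableAt.differentiableWithinAt,
    fun w hw => ⟨(hb w hw.1).1.1.1, fun h => hw.2 ?_⟩, hτ', fun w hw => ?_⟩
  · have h1 : τ w = 0 := h
    rw [Set.mem_singleton_iff, ← (hb w hw.1).1.1.2, h1, hσ0]
  · obtain ⟨⟨⟨-, h1⟩, h2⟩, h3, -⟩ := hb w hw
    rw [Function.comp_apply, h2, h1] at h3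
    exact h3.symm

theorem differentiableOn_update_of_tendsto {g : ℂ → ℂ} {s : Set ℂ} {L : ℂ} (hs : s ∈ 𝓝 0)
    (hg : DifferentiableOn ℂ g (s \ {0})) (hL : Tendsto g (𝓝[≠] 0) (𝓝 L)) :
    DifferentiableOn ℂ (Function.update g 0 L) s := by
  refine (Complex.differentiableOn_compl_singleton_and_continuousAt_iff hs).1
    ⟨hg.congr fun z hz => Function.update_of_ne hz.2 _ _, continuousAt_update_same.2 hL⟩

/-- An injective holomorphic function on the punctured plane has at most a pole at the puncture. -/
theorem tendsto_or_tendsto_inv_of_injOn {g : ℂ → ℂ} (hg : DifferentiableOn ℂ g {0}ᶜ)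
    (hinj : Set.InjOn g {0}ᶜ) :
    (∃ L, Tendsto g (𝓝[≠] 0) (𝓝 L)) ∨ Tendsto (fun z => (g z)⁻¹) (𝓝[≠] 0) (𝓝 0) := by
  have h2 : (2 : ℂ) ∈ ({0}ᶜ : Set ℂ) := by simp
  have himg := nhds_le_map_of_injOn isOpen_compl_singleton hg hinj h2
    (image_mem_map (ball_mem_nhds 2 one_pos))
  obtain ⟨δ, hδ, hb⟩ := Metric.mem_nhds_iff.1 himg
  set b := g 2
  -- The values near b are already taken on the ball of radius 1 about 2, which is disjoint from the
  -- unit disc. Hence 1 / (g - b) is bounded near 0, and its singularity there is removable.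
  have hfar : ∀ z ∈ ball (0 : ℂ) 1, z ≠ 0 → δ ≤ ‖g z - b‖ := by
    intro z hz hz0
    by_contra! hlt
    obtain ⟨w, hw, hwz⟩ := hb (mem_ball_iff_norm.2 hlt)
    have hw0 : w ≠ 0 := by
      rintro rfl
      rw [mem_ball_iff_norm] at hw
      norm_num at hw
    have hwz' : w = z := hinj hw0 hz0 hwz
    rw [hwz', mem_ball_iff_norm] at hw
    rw [mem_ball_zero_iff] at hz
    have := norm_add_le (2 - z) z
    rw [sub_add_cancel, norm_sub_rev] at this
    norm_num at this
    linarith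
  set k : ℂ → ℂ := fun z => (g z - b)⁻¹ with hk
  have hev : ∀ᶠ z in 𝓝[≠] (0 : ℂ), z ∈ ball (0 : ℂ) 1 ∧ z ≠ 0 :=
    inter_mem (nhdsWithin_le_nhds (ball_mem_nhds 0 one_pos)) self_mem_nhdsWithin
  have hne : ∀ᶠ z in 𝓝[≠] (0 : ℂ), g z - b ≠ 0 := by
    filter_upwards [hev] with z hz
    exact norm_pos_iff.1 (hδ.trans_le (hfar z hz.1 hz.2))
  have hkd : ∀ᶠ z in 𝓝[≠] (0 : ℂ), DifferentiableAt ℂ k z := by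
    filter_upwards [hne, hev] with z hz hz'
    exact ((hg.differentiableAt (isOpen_compl_singleton.mem_nhds hz'.2)).sub_const b).inv hz
  have hkb : IsBoundedUnder (· ≤ ·) (𝓝[≠] (0 : ℂ)) fun z => ‖k z - k 0‖ := by
    refine isBoundedUnder_of_eventually_le (a := δ⁻¹ + ‖k 0‖) ?_
    filter_upwards [hev] with z hz
    refine norm_sub_le_of_le ?_ le_rfl
    rw [hk, norm_inv]
    exact inv_anti₀ hδ (hfar z hz.1 hz.2)
  have hlim := Complex.tendsto_limUnder_of_differentiable_on_punctured_nhds_of_bounded_under hkd hkb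
  set ℓ := limUnder (𝓝[≠] (0 : ℂ)) k
  rcases eq_or_ne ℓ 0 with hℓ | hℓ
  · right
    rw [hℓ] at hlim
    have h1 : Tendsto (fun z => k z / (1 + b * k z)) (𝓝[≠] 0) (𝓝 (0 / (1 + b * 0))) :=
      hlim.div ((hlim.const_mul b).const_add 1) (by simp)
    rw [zero_div] at h1
    refine h1.congr' ?_
    filter_upwards [hne] with z hz
    have : 1 + b * k z = g z * k z := by
      rw [hk]
      field_simp
      ring
    rw [this, mul_comm, div_mul_cancel_left₀]
    exact inv_ne_zero hz
  · left
    refine ⟨ℓ⁻¹ + b, ((hlim.inv₀ hℓ).add_const b).congr fun z => ?_⟩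
    simp [hk]

/-- An injective entire function fixing the origin is linear. -/
theorem eq_mul_of_injective {G : ℂ → ℂ} (hG : Differentiable ℂ G) (hinj : Function.Injective G)
    (hG0 : G 0 = 0) : ∃ a : ℂ, a ≠ 0 ∧ ∀ z, G z = a * z := by
  have ha : deriv G 0 ≠ 0 :=
    deriv_ne_zero_of_injOn isOpen_univ hG.differentiableOn hinj.injOn (Set.mem_univ 0)
  have hne : ∀ z, z ≠ 0 → G z ≠ 0 := fun z hz h => hz (hinj (h.trans hG0.symm))
  -- The behaviour of G at infinity is read off at the puncture of w ↦ G (1 / w). A finite limit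
  -- would make G constant.
  have hg₁ : DifferentiableOn ℂ (fun w => G w⁻¹) {0}ᶜ := fun w hw =>
    (hG.differentiableAt.comp w (differentiableAt_inv hw)).differentiableWithinAt
  have hcc : Tendsto (fun z : ℂ => z⁻¹) (cocompact ℂ) (𝓝[≠] 0) := by
    rw [← Metric.cobounded_eq_cocompact]
    exact tendsto_inv₀_cobounded'
  rcases tendsto_or_tendsto_inv_of_injOn hg₁
    (fun w _ w' _ h => inv_injective (hinj h)) with ⟨L, hL⟩ | h0
  · have h1 : Tendsto G (cocompact ℂ) (𝓝 L) := by
      simpa [Function.comp_def] using hL.comp hcc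
    have := hG.eq_const_of_tendsto_cocompact h1
    have h01 : G 0 = G 1 := by rw [this]; rfl
    exact absurd (hinj h01) zero_ne_one
  · set H := Function.update (fun w => (G w⁻¹)⁻¹) 0 0 with hH
    have hHd : DifferentiableOn ℂ H Set.univ := by
      refine differentiableOn_update_of_tendsto univ_mem ?_ h0
      rw [← Set.compl_eq_univ_sdiff]
      exact hg₁.inv fun w hw => hne _ (inv_ne_zero hw)
    have hslope := hasDerivAt_iff_tendsto_slope.1
      (hHd.differentiableAt (x := 0) univ_mem).hasDerivAt
    -- Q is the entire function z / G z. At infinity it tends to H'(0), being the slope of H between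
    -- 0 and 1 / z, so Liouville's theorem makes it constant.
    set Q : ℂ → ℂ := fun z => (dslope G 0 z)⁻¹ with hQ
    have hds : ∀ z, z ≠ 0 → dslope G 0 z = G z / z := fun z hz => by
      rw [dslope_of_ne _ hz, slope_def_field, hG0, sub_zero, sub_zero]
    have hdne : ∀ z, dslope G 0 z ≠ 0 := fun z => by
      rcases eq_or_ne z 0 with rfl | hz
      · rwa [dslope_same]
      · rw [hds z hz]
        exact div_ne_zero (hne z hz) hz
    have hdd : Differentiable ℂ (dslope G 0) := by
      rw [← differentiableOn_univ]
      exact (Complex.differentiableOn_dslope univ_mem).2 hG.differentiableOn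
    have hQd : Differentiable ℂ Q := hdd.inv hdne
    have hQt : Tendsto Q (cocompact ℂ) (𝓝 (deriv H 0)) := by
      refine (hslope.comp hcc).congr' ?_
      have : ∀ᶠ z in cocompact ℂ, z ≠ 0 :=
        (isCompact_singleton (x := (0 : ℂ))).compl_mem_cocompact
      filter_upwards [this] with z hz
      rw [Function.comp_apply, slope_def_field, hH, Function.update_self,
        Function.update_of_ne (inv_ne_zero hz), inv_inv, hQ]
      simp only [sub_zero]
      rw [hds z hz, inv_div, div_inv_eq_mul, div_eq_mul_inv, mul_comm]
    have hconst := hQd.eq_const_of_tendsto_cocompact hQt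
    refine ⟨deriv G 0, ha, fun z => ?_⟩
    have hQz : Q z = Q 0 := by rw [hconst]; rfl
    have hz := sub_smul_dslope G 0 z
    rw [inv_injective hQz, dslope_same, hG0, sub_zero, sub_zero, smul_eq_mul] at hz
    rw [← hz, mul_comm]

/-- As g omits 0, the extension by the value 0 is still injective, and it is entire. -/
theorem eq_mul_of_tendsto_zero {g : ℂ → ℂ} (hg : DifferentiableOn ℂ g {0}ᶜ)
    (hinj : Set.InjOn g {0}ᶜ) (hne : ∀ z, z ≠ 0 → g z ≠ 0) (h0 : Tendsto g (𝓝[≠] 0) (𝓝 0)) :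
    ∃ a : ℂ, a ≠ 0 ∧ ∀ z, z ≠ 0 → g z = a * z := by
  have hd : DifferentiableOn ℂ (Function.update g 0 0) Set.univ :=
    differentiableOn_update_of_tendsto univ_mem (by rwa [← Set.compl_eq_univ_sdiff]) h0
  have hoff : ∀ z, z ≠ 0 → Function.update g 0 0 z = g z := fun z hz =>
    Function.update_of_ne hz _ _
  have hinj' : Function.Injective (Function.update g 0 0) := by
    intro z w hzw
    rcases eq_or_ne z 0 with rfl | hz <;> rcases eq_or_ne w 0 with rfl | hw
    · rfl
    · rw [Function.update_self, hoff w hw] at hzw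
      exact absurd hzw.symm (hne w hw)
    · rw [Function.update_self, hoff z hz] at hzw
      exact absurd hzw (hne z hz)
    · rw [hoff z hz, hoff w hw] at hzw
      exact hinj hz hw hzw
  obtain ⟨a, ha, h⟩ := eq_mul_of_injective (differentiableOn_univ.1 hd) hinj'
    (Function.update_self ..)
  exact ⟨a, ha, fun z hz => (hoff z hz).symm.trans (h z)⟩

/-- Injective holomorphic self-maps of the punctured plane, up to those extending across the
puncture with a nonzero value, are the maps `a z` and `1 / (a z)`. -/
theorem injOn_puncturedPlane_cases {g : ℂ → ℂ} (hg : DifferentiableOn ℂ g {0}ᶜ)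
    (hinj : Set.InjOn g {0}ᶜ) (hne : ∀ z, z ≠ 0 → g z ≠ 0) :
    (∃ L, L ≠ 0 ∧ Differentiable ℂ (Function.update g 0 L)) ∨
      (∃ a : ℂ, a ≠ 0 ∧ ∀ z, z ≠ 0 → g z = a * z) ∨
      ∃ a : ℂ, a ≠ 0 ∧ ∀ z, z ≠ 0 → g z = (a * z)⁻¹ := by
  rcases tendsto_or_tendsto_inv_of_injOn hg hinj with ⟨L, hL⟩ | h0
  · rcases eq_or_ne L 0 with rfl | hL0
    · exact Or.inr (Or.inl (eq_mul_of_tendsto_zero hg hinj hne hL))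
    · refine Or.inl ⟨L, hL0, differentiableOn_univ.1 ?_⟩
      exact differentiableOn_update_of_tendsto univ_mem (by rwa [← Set.compl_eq_univ_sdiff]) hL
  · obtain ⟨a, ha, h⟩ := eq_mul_of_tendsto_zero (hg.inv hne)
      (fun z hz w hw h => hinj hz hw (inv_injective h)) (fun z hz => inv_ne_zero (hne z hz)) h0
    exact Or.inr (Or.inr ⟨a, ha, fun z hz => by rw [← h z hz]; simp⟩)

end ComplexAnalysis

/-! ### The case analysis on the punctured disc and the punctured plane -/

section Main

/-- The identity is a linearizing coordinate. The radius R / (2 (1 + |a|)) keeps both the circle and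
its image inside the ball. -/
theorem not_isWeaklySupercyclic_of_eq_mul {U : Set ℂ} {φ : C(U, U)} (hφ : IsSymbol φ) {a : ℂ}
    (ha : a ≠ 0) {R : ℝ} (hR : 0 < R) (hRU : ball 0 R \ {0} ⊆ U)
    (h : ∀ z : U, (φ z : ℂ) = a * z) : ¬ IsWeaklySupercyclic (compOp U φ hφ) := by
  have h1 : 0 < 1 + ‖a‖ := by positivity
  have hk : R / (1 + ‖a‖) / 2 * (1 + ‖a‖) < R := by
    rw [div_div, div_mul_eq_mul_div, div_lt_iff₀ (by positivity)]
    nlinarith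
  have hρ : 0 < R / (1 + ‖a‖) / 2 := by positivity
  refine not_isWeaklySupercyclic_of_linearization hφ (τ := fun z => z) ha hρ ?_ ?_
    differentiableOn_id hRU (by simp) fun w hw _ => h ⟨w, hRU hw⟩
  · nlinarith [norm_nonneg a]
  · nlinarith [norm_nonneg a]

theorem not_isWeaklySupercyclic_puncturedDisc (φ : C(puncturedDisc, puncturedDisc))
    (hφ : IsSymbol φ) : ¬ IsWeaklySupercyclic (compOp puncturedDisc φ hφ) := by
  by_cases hinj : Function.Injective φ
  swap
  · exact not_isWeaklySupercyclic_of_not_injective hφ hinj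
  obtain ⟨g, hg, hφg⟩ := (isSymbol_iff φ).1 hφ
  have hball : ball (0 : ℂ) 1 ∈ 𝓝 0 := ball_mem_nhds 0 one_pos
  have hgU : ∀ z ∈ puncturedDisc, g z ∈ puncturedDisc := fun z hz => hφg ⟨z, hz⟩ ▸ (φ _).2
  have hg1 : ∀ z ∈ puncturedDisc, ‖g z‖ < 1 := fun z hz => mem_ball_zero_iff.1 (hgU z hz).1
  set G := Function.update g 0 (limUnder (𝓝[≠] 0) g) with hGdef
  have hG : DifferentiableOn ℂ G (ball 0 1) := by
    refine Complex.differentiableOn_update_limUnder_of_bddAbove hball hg ⟨1, ?_⟩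
    rintro _ ⟨z, hz, rfl⟩
    exact (hg1 z hz).le
  have hGg : ∀ z ∈ puncturedDisc, G z = g z := fun z hz => Function.update_of_ne hz.2 _ _
  have hφG : ∀ z : puncturedDisc, (φ z : ℂ) = G z := fun z => (hφg z).trans (hGg z z.2).symm
  have hev : ∀ᶠ z in 𝓝[≠] (0 : ℂ), z ∈ puncturedDisc :=
    inter_mem (nhdsWithin_le_nhds hball) self_mem_nhdsWithin
  have hGlt : ∀ z ∈ puncturedDisc, ‖G z‖ < 1 := fun z hz => hGg z hz ▸ hg1 z hz
  have hGd0 : DifferentiableAt ℂ G 0 := hG.differentiableAt hball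
  -- By the maximum principle: otherwise |G| has a local maximum at 0, and G is constant near 0 with
  -- modulus at least 1.
  have hG01 : ‖G 0‖ < 1 := by
    by_contra! hge
    have hmax : IsLocalMax (norm ∘ G) 0 := by
      filter_upwards [hball] with z hz
      rcases eq_or_ne z 0 with rfl | hz0
      · exact le_rfl
      · exact (hGlt z ⟨hz, hz0⟩).le.trans hge
    have hconst := Complex.eventually_eq_of_isLocalMax_norm
      (by filter_upwards [isOpen_ball.mem_nhds (mem_ball_self one_pos)] with z hz
            using hG.differentiableAt (isOpen_ball.mem_nhds hz)) hmax
    obtain ⟨z, hz, hzU⟩ := ((hconst.filter_mono nhdsWithin_le_nhds).and hev).exists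
    exact (hGlt z hzU).not_ge (hz ▸ hge)
  have hGball : Set.MapsTo G (ball 0 1) (ball 0 1) := fun z hz => by
    rw [mem_ball_zero_iff]
    rcases eq_or_ne z 0 with rfl | hz0
    · exact hG01
    · exact hGlt z ⟨hz, hz0⟩
  rcases ne_or_eq (G 0) 0 with hG0 | hG0
  · exact not_isWeaklySupercyclic_of_extends hφ (fun h => h.2 rfl) one_pos subset_rfl hG
      ⟨mem_ball_zero_iff.2 hG01, hG0⟩ hφG
  have hGinj : Set.InjOn G (ball 0 1) := by
    have hne : ∀ z ∈ puncturedDisc, G z ≠ 0 := fun z hz => hGg z hz ▸ (hgU z hz).2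
    intro z hz w hw hzw
    rcases eq_or_ne z 0 with rfl | hz0 <;> rcases eq_or_ne w 0 with rfl | hw0
    · rfl
    · exact absurd (hzw.symm.trans hG0) (hne w ⟨hw, hw0⟩)
    · exact absurd (hzw.trans hG0) (hne z ⟨hz, hz0⟩)
    · have : φ ⟨z, hz, hz0⟩ = φ ⟨w, hw, hw0⟩ := Subtype.ext (by rw [hφG, hφG, hzw])
      exact congrArg Subtype.val (hinj this)
  have hc := deriv_ne_zero_of_injOn isOpen_ball hG hGinj (mem_ball_self one_pos)
  have hmaps : Set.MapsTo G (ball 0 1) (closedBall (G 0) 1) := by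
    rw [hG0]
    exact hGball.mono_right ball_subset_closedBall
  -- Schwarz's lemma: either 0 is attracting and Koenigs' theorem applies, or G is a rotation.
  rcases (Complex.norm_deriv_le_one_of_mapsTo_ball hG hmaps one_pos).lt_or_eq with hlt | heq
  · obtain ⟨τ, R, hR, hτ, hτU, hτ', hconj⟩ := exists_linearization
      (hG.analyticAt hball) hG0 rfl hc hlt hball
    have hτU' : Set.MapsTo τ (ball 0 R \ {0}) puncturedDisc := hτU
    have hR2 : 0 < R / 2 := half_pos hR
    refine not_isWeaklySupercyclic_of_linearization hφ hc hR2 (half_lt_self hR) ?_ hτ hτU' hτ'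
      fun w hw _ => (hφG _).trans (hconj w hw.1)
    nlinarith
  · have haff := Complex.affine_of_mapsTo_ball_of_norm_dslope_eq_div hG hmaps
      (mem_ball_self one_pos) (by rw [dslope_same, heq, div_one])
    refine not_isWeaklySupercyclic_of_eq_mul hφ hc one_pos subset_rfl fun z => ?_
    rw [hφG, haff z.2.1, hG0, dslope_same]
    simp [mul_comm]

theorem not_isWeaklySupercyclic_puncturedPlane (φ : C(puncturedPlane, puncturedPlane))
    (hφ : IsSymbol φ) : ¬ IsWeaklySupercyclic (compOp puncturedPlane φ hφ) := by
  by_cases hinj : Function.Injective φ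
  swap
  · exact not_isWeaklySupercyclic_of_not_injective hφ hinj
  obtain ⟨g, hg, hφg⟩ := (isSymbol_iff φ).1 hφ
  have hne : ∀ z, z ≠ 0 → g z ≠ 0 := fun z hz => hφg ⟨z, hz⟩ ▸ (φ _).2
  have hginj : Set.InjOn g {0}ᶜ := fun z hz w hw hzw =>
    congrArg Subtype.val (hinj (Subtype.ext ((hφg ⟨z, hz⟩).trans (hzw.trans (hφg ⟨w, hw⟩).symm))))
  have hsub : ball (0 : ℂ) 1 \ {0} ⊆ puncturedPlane := fun z hz => hz.2
  rcases injOn_puncturedPlane_cases hg hginj hne with ⟨L, hL, hd⟩ | ⟨a, ha, h⟩ | ⟨a, ha, h⟩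
  · refine not_isWeaklySupercyclic_of_extends hφ (fun h => h rfl) one_pos hsub hd.differentiableOn
      ?_ fun z => ?_
    · rw [Function.update_self]
      exact hL
    · rw [hφg, Function.update_of_ne z.2]
  · exact not_isWeaklySupercyclic_of_eq_mul hφ ha one_pos hsub fun z =>
      (hφg z).trans (h z z.2)
  · have hinv : ∀ z, φ (φ z) = z := by
      intro z
      have hz : (z : ℂ) ≠ 0 := z.2
      refine Subtype.ext ?_
      rw [hφg, hφg, h _ (hne z hz), h z hz]
      field_simp
    have h1 : (1 : ℂ) ∈ puncturedPlane := one_ne_zero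
    have h2 : (2 : ℂ) ∈ puncturedPlane := two_ne_zero
    refine not_isWeaklySupercyclic_of_involutive (Λ := evalAt ⟨1, h1⟩) (M := evalAt ⟨2, h2⟩)
      (u := restrict _ (fun _ => 1) (differentiableOn_const 1))
      (v := restrict _ (fun z => z) differentiableOn_id) ?_ fun f => ?_
    · change (1 : ℂ) * 2 - 1 * 1 ≠ 0
      norm_num
    · refine Subtype.ext (ContinuousMap.ext fun z => ?_)
      exact congrArg f.1 (hinv z)

end Main

end WeakSupercyclic

theorem theorem3p5 :
    (∀ (φ : C(WeakSupercyclic.puncturedDisc, WeakSupercyclic.puncturedDisc))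
        (hφ : WeakSupercyclic.IsSymbol φ),
      ¬ WeakSupercyclic.IsWeaklySupercyclic
          (WeakSupercyclic.compOp WeakSupercyclic.puncturedDisc φ hφ)) ∧
    (∀ (φ : C(WeakSupercyclic.puncturedPlane, WeakSupercyclic.puncturedPlane))
        (hφ : WeakSupercyclic.IsSymbol φ),
      ¬ WeakSupercyclic.IsWeaklySupercyclic
          (WeakSupercyclic.compOp WeakSupercyclic.puncturedPlane φ hφ)) :=
  ⟨WeakSupercyclic.not_isWeaklySupercyclic_puncturedDisc,
    WeakSupercyclic.not_isWeaklySupercyclic_puncturedPlane⟩
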